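/- A group-lattice pair $(G,A)$ consists of a group $G$ and a finitely generated abelian normal subgroup $A\trianglelefteq G$ (the lattice) of finite index $[G:A]<\infty$; the quotient $G/A$ is called its point group. Let $\widehat{A}=\operatorname{Hom}(A,\mathbb{T})$ be the group of characters of the discrete group $A$, on which $G/A$ acts by $(gA\cdot\chi)(a)=\chi(g^{-1}ag)$. The pair $(G,A)$ is called crystal-like if there is $\chi\in\widehat{A}$ whose orbit $\mathcal{O}_\chi$ under this action satisfies $|\mathcal{O}_\chi|=[G:A]$. Corollary 4.13. Let $G$ be a group with group-lattice pairs $(G,A_1)$ and $(G,A_2)$. If both $(G,A_1)$ and $(G,A_2)$ are crystal-like, then $[G:A_1]=[G:A_2]$; that is, the point groups $G/A_1$ and $G/A_2$ have the same order. -/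

import Mathlib

/-- A group-lattice pair `(G, A)`: a normal, finitely generated, abelian subgroup `A` (the lattice)
of finite index in the group `G`. -/
structure GroupLatticePair (G : Type*) [Group G] where
  lattice : Subgroup G
  normal : lattice.Normal
  comm : ∀ a ∈ lattice, ∀ b ∈ lattice, a * b = b * a
  fg : lattice.FG
  finiteIndex : lattice.FiniteIndex

namespace GroupLatticePair

attribute [instance] GroupLatticePair.normal GroupLatticePair.finiteIndex

/-- The point group `G ⧸ A` of the pair. -/
abbrev PointGroup {G : Type*} [Group G] (P : GroupLatticePair G) : Type _ :=
  G ⧸ P.lattice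

/-- The Pontryagin dual of the lattice, a discrete abelian group: all homomorphisms from the
lattice to the circle group. -/
abbrev Characters {G : Type*} [Group G] (P : GroupLatticePair G) : Type _ :=
  P.lattice →* Circle

/-- Conjugation `a ↦ g * a * g⁻¹` on the lattice descends to an action of the point group by
automorphisms, because the lattice is abelian. -/
def conj {G : Type*} [Group G] (P : GroupLatticePair G) : P.PointGroup →* MulAut P.lattice :=
  QuotientGroup.lift P.lattice MulAut.conjNormal (by
    intro g hg
    ext a
    simp [MulAut.conjNormal_apply, P.comm g hg a a.2])

/-- The induced action of the point group on characters, `(d • χ) a = χ (d⁻¹ • a)`. -/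
noncomputable instance instMulActionCharacters {G : Type*} [Group G] (P : GroupLatticePair G) :
    MulAction P.PointGroup P.Characters where
  smul d χ := χ.comp (P.conj d⁻¹).toMonoidHom
  one_smul χ := by
    change χ.comp (P.conj 1⁻¹).toMonoidHom = χ
    ext a
    simp
  mul_smul d e χ := by
    change χ.comp (P.conj (d * e)⁻¹).toMonoidHom =
      (χ.comp (P.conj e⁻¹).toMonoidHom).comp (P.conj d⁻¹).toMonoidHom
    ext a
    simp [mul_inv_rev, map_mul]

theorem smul_apply {G : Type*} [Group G] (P : GroupLatticePair G) (g : G) (χ : P.Characters)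
    (a : P.lattice) :
    ((g : P.PointGroup) • χ) a =
      χ ⟨g⁻¹ * a * g, by simpa using P.normal.conj_mem a a.2 g⁻¹⟩ := by
  change χ (MulAut.conjNormal g⁻¹ a) = _
  congr 1
  ext
  simp

/-- A pair `(G, A)` is crystal-like if some character of `A` has an orbit of size `[G : A]` under
the action of the point group. -/
def IsCrystalLike {G : Type*} [Group G] (P : GroupLatticePair G) : Prop :=
  ∃ χ : P.Characters, Nat.card (MulAction.orbit P.PointGroup χ) = P.lattice.index

end GroupLatticePair

/-! Let `χ` have a free orbit under the point group of `P`. The representation of `G` induced from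
`χ` is then irreducible in the sense needed: the lattice acts diagonally, with a different character
on each coset, so a nonzero stable subspace contains functions supported on each single coset and
has dimension at least `P.lattice.index` (`index_le_finrank_of_stable`). Any other lattice, being
abelian, has a common eigenvector in this space. Its `G`-translates span a stable subspace of
dimension at most the index of that lattice (`finrank_span_rightTranslation_le`). Comparing the two
bounds and exchanging the lattices gives equality. -/

/-- A family of commuting endomorphisms has a common eigenvector in every nonzero
finite-dimensional complex subspace that is stable under all of them. -/
theorem exists_common_eigenvector {M ι : Type*} [AddCommGroup M] [Module ℂ M]
    (f : ι → Module.End ℂ M) (hcomm : ∀ i j v, f i (f j v) = f j (f i v))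
    (V : Submodule ℂ M) [FiniteDimensional ℂ V] (hV : V ≠ ⊥)
    (hinv : ∀ i, ∀ v ∈ V, f i v ∈ V) :
    ∃ v ∈ V, v ≠ 0 ∧ ∀ i, ∃ μ : ℂ, f i v = μ • v := by
  induction hn : Module.finrank ℂ V using Nat.strong_induction_on generalizing V with
  | _ n ih =>
  subst hn
  by_cases hall : ∀ i, ∃ μ : ℂ, ∀ v ∈ V, f i v = μ • v
  · obtain ⟨v, hv, hv0⟩ := V.exists_mem_ne_zero_of_ne_bot hV
    exact ⟨v, hv, hv0, fun i => (hall i).imp fun μ h => h v hv⟩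
  · push Not at hall
    obtain ⟨i, hi⟩ := hall
    have : Nontrivial V := Submodule.nontrivial_iff_ne_bot.mpr hV
    obtain ⟨μ, hμ⟩ := Module.End.exists_eigenvalue ((f i).restrict (hinv i))
    obtain ⟨w, hw⟩ := hμ.exists_hasEigenvector
    have hfw : f i w = μ • (w : M) := congrArg Subtype.val hw.apply_eq_smul
    set V' : Submodule ℂ M := V ⊓ (f i).eigenspace μ with hV'
    have hle : V' ≤ V := inf_le_left
    have : FiniteDimensional ℂ V' := Submodule.finiteDimensional_of_le hle
    have hne : V' ≠ ⊥ := by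
      intro h
      have hw' : (w : M) ∈ V' := ⟨w.2, Module.End.mem_eigenspace_iff.mpr hfw⟩
      rw [h, Submodule.mem_bot] at hw'
      exact hw.2 (Subtype.ext hw')
    -- The inclusion is proper because `f i` is not scalar on `V`.
    have hlt : V' < V := by
      refine lt_of_le_of_ne hle fun h => ?_
      obtain ⟨v, hv, hvne⟩ := hi μ
      rw [← h] at hv
      exact hvne (Module.End.mem_eigenspace_iff.mp hv.2)
    obtain ⟨v, hv, h⟩ := ih _ (Submodule.finrank_lt_finrank_of_lt hlt) V' hne
      (fun j v hv => ⟨hinv j v hv.1, Module.End.mem_eigenspace_iff.mpr (by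
        rw [hcomm, Module.End.mem_eigenspace_iff.mp hv.2, map_smul])⟩) rfl
    exact ⟨v, hle hv, h⟩

/-- Right translation of functions on a group. -/
def rightTranslation {G : Type*} [Group G] (g : G) : Module.End ℂ (G → ℂ) :=
  LinearMap.funLeft ℂ ℂ (· * g)

@[simp]
theorem rightTranslation_apply {G : Type*} [Group G] (g : G) (f : G → ℂ) (x : G) :
    rightTranslation g f x = f (x * g) := rfl

theorem rightTranslation_mul {G : Type*} [Group G] (g h : G) (f : G → ℂ) :
    rightTranslation (g * h) f = rightTranslation g (rightTranslation h f) := by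
  ext x
  simp [mul_assoc]

/-- The cyclic space generated by a common eigenvector of a finite-index subgroup has dimension
at most the index. -/
theorem finrank_span_rightTranslation_le {G : Type*} [Group G] (H : Subgroup G) [H.FiniteIndex]
    (v : G → ℂ) (hv : ∀ h ∈ H, ∃ μ : ℂ, rightTranslation h v = μ • v) :
    FiniteDimensional ℂ (Submodule.span ℂ (Set.range fun g : G => rightTranslation g v)) ∧
      Module.finrank ℂ (Submodule.span ℂ (Set.range fun g : G => rightTranslation g v)) ≤
        H.index := by
  have hspan : Submodule.span ℂ (Set.range fun g : G => rightTranslation g v) =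
      Submodule.span ℂ (Set.range fun q : G ⧸ H => rightTranslation q.out v) := by
    apply le_antisymm
    · rw [Submodule.span_le]
      rintro _ ⟨g, rfl⟩
      obtain ⟨h, hh⟩ := QuotientGroup.mk_out_eq_mul H g
      -- The representative differs from `g` by a right factor in `H`, which acts on `v` first and
      -- only rescales it.
      obtain ⟨μ, hμ⟩ := hv (h : G)⁻¹ (H.inv_mem h.2)
      have hg : g = (g : G ⧸ H).out * (h : G)⁻¹ := by rw [hh]; group
      have : rightTranslation g v = μ • rightTranslation (g : G ⧸ H).out v := by
        conv_lhs => rw [hg]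
        rw [rightTranslation_mul, hμ, map_smul]
      change rightTranslation g v ∈ _
      rw [this]
      exact Submodule.smul_mem _ _ (Submodule.subset_span ⟨_, rfl⟩)
    · apply Submodule.span_mono
      rintro _ ⟨q, rfl⟩
      exact ⟨q.out, rfl⟩
  rw [hspan]
  have := Fintype.ofFinite (G ⧸ H)
  refine ⟨FiniteDimensional.span_of_finite ℂ (Set.finite_range _), ?_⟩
  rw [Subgroup.index, Nat.card_eq_fintype_card]
  exact finrank_range_le_card _

namespace GroupLatticePair

variable {G : Type*} [Group G] (P : GroupLatticePair G)

/-- The space of the representation of `G` induced from a character of the lattice. -/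
def inducedSpace (χ : P.Characters) : Submodule ℂ (G → ℂ) where
  carrier := {f | ∀ (a : P.lattice) (x : G), f (a * x) = χ a * f x}
  zero_mem' := by simp
  add_mem' hf hg a x := by simp [hf a x, hg a x, mul_add]
  smul_mem' c f hf a x := by simp [hf a x, mul_left_comm]

variable {P} {χ : P.Characters}

theorem rightTranslation_mem_inducedSpace {f : G → ℂ} (hf : f ∈ P.inducedSpace χ) (g : G) :
    rightTranslation g f ∈ P.inducedSpace χ := fun a x => by
  simpa [mul_assoc] using hf a (x * g)

/-- Since `x * a = (x * a * x⁻¹) * x`, equivariance pulls out a conjugate character that depends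
only on the coset of `x`. -/
theorem rightTranslation_apply_of_mem_inducedSpace {f : G → ℂ} (hf : f ∈ P.inducedSpace χ)
    (a : P.lattice) (x : G) :
    rightTranslation (a : G) f x = (((x : P.PointGroup)⁻¹ • χ) a : ℂ) * f x := by
  rw [← QuotientGroup.mk_inv, smul_apply, ← hf, rightTranslation_apply]
  congr 1
  simp

theorem eq_zero_iff_of_mem_inducedSpace {f : G → ℂ} (hf : f ∈ P.inducedSpace χ) {x y : G}
    (hxy : (x : P.PointGroup) = y) : f x = 0 ↔ f y = 0 := by
  have h : y * x⁻¹ ∈ P.lattice := by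
    rw [← QuotientGroup.eq_one_iff]
    simp [hxy]
  have := hf ⟨y * x⁻¹, h⟩ x
  simp only [inv_mul_cancel_right] at this
  simp [this]

theorem inducedSpace_ne_bot : P.inducedSpace χ ≠ ⊥ := by
  classical
  refine (Submodule.ne_bot_iff _).mpr
    ⟨fun g => if h : g ∈ P.lattice then (χ ⟨g, h⟩ : ℂ) else 0, fun a x => ?_, fun h => ?_⟩
  · by_cases hx : x ∈ P.lattice
    · have : (⟨a * x, mul_mem a.2 hx⟩ : P.lattice) = a * ⟨x, hx⟩ := rfl
      simp [hx, P.lattice.mul_mem_cancel_left a.2, this]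
    · simp [hx, P.lattice.mul_mem_cancel_left a.2]
  · have h1 := congrFun h 1
    simp [P.lattice.one_mem] at h1

instance : FiniteDimensional ℂ (P.inducedSpace χ) := by
  have : Finite P.PointGroup := inferInstance
  -- Equivariance determines a function by its values at coset representatives.
  refine FiniteDimensional.of_injective
    ((LinearMap.funLeft ℂ ℂ (Quotient.out : P.PointGroup → G)).comp
      (P.inducedSpace χ).subtype) ?_
  rw [← LinearMap.ker_eq_bot, LinearMap.ker_eq_bot']
  intro f hf
  ext x
  have h := congrFun hf (x : P.PointGroup)
  exact (eq_zero_iff_of_mem_inducedSpace f.2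
    (QuotientGroup.out_eq' (x : P.PointGroup))).mp h

theorem smul_injective_of_card_orbit
    (h : Nat.card (MulAction.orbit P.PointGroup χ) = P.lattice.index) :
    Function.Injective fun d : P.PointGroup => d • χ := by
  have : Finite P.PointGroup := inferInstance
  have : Finite (MulAction.orbit P.PointGroup χ) := Set.finite_range _
  have hb : Function.Bijective
      (Set.rangeFactorization fun d : P.PointGroup => d • χ) :=
    (Nat.bijective_iff_surjective_and_card _).mpr ⟨Set.rangeFactorization_surjective, h.symm⟩
  intro d e hde
  exact hb.1 (Subtype.ext hde)

/-- If the characters conjugate to `χ` are distinct, a function in a translation-stable subspace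
of the induced space can be cut off to any coset of the lattice inside that subspace. -/
theorem exists_mem_eq_zero_off_coset (hχ : Function.Injective fun d : P.PointGroup => d • χ)
    {W : Submodule ℂ (G → ℂ)} (hW : W ≤ P.inducedSpace χ)
    (hinv : ∀ g, ∀ w ∈ W, rightTranslation g w ∈ W) {f : G → ℂ} (hf : f ∈ W) (x₀ : G) :
    ∃ w ∈ W, w x₀ = f x₀ ∧ ∀ x : G, (x : P.PointGroup) ≠ x₀ → w x = 0 := by
  classical
  have := Fintype.ofFinite P.PointGroup
  have key : ∀ S : Finset P.PointGroup, ∃ w ∈ W, w x₀ = f x₀ ∧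
      ∀ x : G, (x : P.PointGroup) ∈ S → (x : P.PointGroup) ≠ x₀ → w x = 0 := by
    intro S
    induction S using Finset.induction_on with
    | empty => exact ⟨f, hf, rfl, by simp⟩
    | insert c S _ ih =>
      obtain ⟨w, hw, hw₀, hwS⟩ := ih
      by_cases hc : c = x₀
      · refine ⟨w, hw, hw₀, fun x hx hne => hwS x ?_ hne⟩
        exact (Finset.mem_insert.mp hx).resolve_left fun h => hne (h.trans hc)
      have hne : c⁻¹ • χ ≠ (x₀ : P.PointGroup)⁻¹ • χ := fun h => hc (inv_injective (hχ h))
      obtain ⟨a, ha⟩ := DFunLike.ne_iff.mp hne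
      have hd : (((x₀ : P.PointGroup)⁻¹ • χ) a : ℂ) - ((c⁻¹ • χ) a : ℂ) ≠ 0 :=
        sub_ne_zero.mpr fun h => ha (Circle.ext h.symm)
      -- This operator multiplies by a scalar on each coset: 1 on that of `x₀`, 0 on `c`. Zeros
      -- already obtained on `S` therefore persist.
      refine ⟨((((x₀ : P.PointGroup)⁻¹ • χ) a : ℂ) - ((c⁻¹ • χ) a : ℂ))⁻¹ •
        (rightTranslation (a : G) w - ((c⁻¹ • χ) a : ℂ) • w),
        W.smul_mem _ (W.sub_mem (hinv _ _ hw) (W.smul_mem _ hw)), ?_, fun x hx hxne => ?_⟩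
      · rw [Pi.smul_apply, Pi.sub_apply, Pi.smul_apply,
          rightTranslation_apply_of_mem_inducedSpace (hW hw), smul_eq_mul, smul_eq_mul,
          ← sub_mul, inv_mul_cancel_left₀ hd, hw₀]
      · rw [Pi.smul_apply, Pi.sub_apply, Pi.smul_apply,
          rightTranslation_apply_of_mem_inducedSpace (hW hw), smul_eq_mul, smul_eq_mul]
        rcases Finset.mem_insert.mp hx with h | h
        · simp [h]
        · simp [hwS x h hxne]
  obtain ⟨w, hw, hw₀, h⟩ := key Finset.univ
  exact ⟨w, hw, hw₀, fun x => h x (Finset.mem_univ _)⟩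

/-- When the characters conjugate to `χ` are distinct, a nonzero translation-stable subspace of
the induced space has full dimension. -/
theorem index_le_finrank_of_stable (hχ : Function.Injective fun d : P.PointGroup => d • χ)
    {W : Submodule ℂ (G → ℂ)} [FiniteDimensional ℂ W] (hW : W ≤ P.inducedSpace χ)
    (hinv : ∀ g, ∀ w ∈ W, rightTranslation g w ∈ W) (hne : W ≠ ⊥) :
    P.lattice.index ≤ Module.finrank ℂ W := by
  have := Fintype.ofFinite P.PointGroup
  obtain ⟨v, hv, hv0⟩ := W.exists_mem_ne_zero_of_ne_bot hne
  obtain ⟨y, hy⟩ := Function.ne_iff.mp hv0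
  have hex : ∀ c : P.PointGroup, ∃ w : W, (w : G → ℂ) c.out ≠ 0 ∧
      ∀ d : P.PointGroup, d ≠ c → (w : G → ℂ) d.out = 0 := by
    intro c
    -- This translate carries the nonzero value of `v` at `y` to the point `c.out`.
    obtain ⟨w, hw, hw₀, hoff⟩ := exists_mem_eq_zero_off_coset hχ hW hinv
      (hinv (c.out⁻¹ * y) v hv) c.out
    refine ⟨⟨w, hw⟩, ?_, fun d hd => hoff _ ?_⟩
    · simpa [hw₀] using hy
    · rwa [QuotientGroup.out_eq', QuotientGroup.out_eq']
  choose w hwne hwoff using hex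
  -- Evaluation at the representatives is diagonal on the family `w`, with nonzero diagonal entries.
  have hli : LinearIndependent ℂ w := by
    rw [Fintype.linearIndependent_iff]
    intro t ht c
    have h := congrFun (congrArg Subtype.val ht) c.out
    rw [Submodule.coe_sum, Finset.sum_apply, Finset.sum_eq_single c] at h
    · exact (mul_eq_zero.mp h).resolve_right (hwne c)
    · intro d _ hd
      simp [hwoff d c hd.symm]
    · simp
  rw [Subgroup.index, Nat.card_eq_fintype_card]
  exact hli.fintype_card_le_finrank

/-- The index of a crystal-like lattice is at most that of any other lattice. -/
theorem IsCrystalLike.index_le (hP : P.IsCrystalLike) (Q : GroupLatticePair G) :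
    P.lattice.index ≤ Q.lattice.index := by
  obtain ⟨χ, hχ⟩ := hP
  obtain ⟨v, hv, hv0, heig⟩ := exists_common_eigenvector
    (fun b : Q.lattice => rightTranslation (b : G))
    (fun a b f => by
      rw [← rightTranslation_mul, ← rightTranslation_mul, Q.comm a a.2 b b.2])
    (P.inducedSpace χ) inducedSpace_ne_bot
    (fun b f hf => rightTranslation_mem_inducedSpace hf b)
  obtain ⟨hfin, hle⟩ := finrank_span_rightTranslation_le Q.lattice v
    fun h hh => heig ⟨h, hh⟩
  refine le_trans (index_le_finrank_of_stable (smul_injective_of_card_orbit hχ) ?_ ?_ ?_) hle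
  · rw [Submodule.span_le]
    rintro _ ⟨g, rfl⟩
    exact rightTranslation_mem_inducedSpace hv g
  · intro g w hw
    have hmap : Submodule.span ℂ (Set.range fun g : G => rightTranslation g v) ≤
        (Submodule.span ℂ (Set.range fun g : G => rightTranslation g v)).comap
          (rightTranslation g) := by
      rw [Submodule.span_le]
      rintro _ ⟨h, rfl⟩
      exact Submodule.subset_span ⟨g * h, rightTranslation_mul g h v⟩
    exact hmap hw
  · refine (Submodule.ne_bot_iff _).mpr ⟨v, Submodule.subset_span ⟨1, ?_⟩, hv0⟩
    ext x
    simp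

end GroupLatticePair

theorem corollary4p13 {G : Type*} [Group G] (P₁ P₂ : GroupLatticePair G)
    (h₁ : P₁.IsCrystalLike) (h₂ : P₂.IsCrystalLike) :
    P₁.lattice.index = P₂.lattice.index ∧
      Nat.card P₁.PointGroup = Nat.card P₂.PointGroup := by
  have h := le_antisymm (h₁.index_le P₂) (h₂.index_le P₁)
  exact ⟨h, h⟩
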